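/- Let $\mathbb D=\{z\in\mathbb C:|z|<1\}$. For $0<\alpha<1$, an analytic function $f$ on $\mathbb D$ with $f(0)=0$ and $f'(0)=1$ is called strongly starlike of order $\alpha$ if $|\arg[zf'(z)/f(z)]|<\pi\alpha/2$ for all $z\in\mathbb D$; this includes the requirement that $f(z)\neq0$ and $f'(z)\ne 0$ for $0<|z|<1$, and the quotient is given its limit value $1$ at $z=0$. Let ${}_2F_1(a,b;c;z)=\sum_{n\ge0}\frac{(a)_n(b)_n}{(c)_n\,n!}z^n$ for $|z|<1$ and $c\neq0,-1,-2,\dots$, where $(x)_0=1$ and $(x)_n=x(x+1)\cdots(x+n-1)$ for $n\ge 1$. Let $\alpha$ be a real number with $0<\alpha<1$ and let $a,b$ be complex numbers with $ab\neq0$ and $a+b\neq-1,-2,-3,\dots$. Then the function $z\,{}_2F_1(a,b;a+b+1;z)$ is strongly starlike of order $\alpha$ if (i) $|\arg(ab)|<\pi\alpha/2$ (principal argument), and (ii) for all $s\in(0,+\infty)$ and both signs $\varepsilon=\pm1$, $$2s^{2\alpha}\,\mathrm{Re}\big[e^{-\varepsilon\pi i\alpha}ab\big]+2s^{\alpha}\,\mathrm{Re}\big[e^{-\varepsilon\pi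 i\alpha/2}ab(\bar a+\bar b-2)\big]+|ab|^2-2\,\mathrm{Re}\big[ab(\bar a+\bar b-1)\big]\le\alpha(s+s^{-1})s^{\alpha}\,\mathrm{Re}\big[e^{\varepsilon\pi i(1-\alpha)/2}ab\big].$$ -/

import Mathlib

/-- `f` is strongly starlike of order `α`: it is analytic on the unit disk `𝔻`, normalized by
`f 0 = 0` and `f' 0 = 1`, and `|arg (z f'(z) / f(z))| < π α / 2` on `𝔻`.
At `z = 0` the quotient `z f'(z) / f(z)` has the removable value `1`, whose argument is `0`, so the
condition is only imposed at `z ≠ 0`. That the argument is meaningful, i.e. that the quotient is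
finite and nonzero, is part of the definition. -/
structure IsStronglyStarlikeOfOrder (α : ℝ) (f : ℂ → ℂ) : Prop where
  analytic : AnalyticOnNhd ℂ f (Metric.ball (0 : ℂ) 1)
  map_zero : f 0 = 0
  deriv_zero : deriv f 0 = 1
  ne_zero : ∀ z ∈ Metric.ball (0 : ℂ) 1, z ≠ 0 → f z ≠ 0
  deriv_ne_zero : ∀ z ∈ Metric.ball (0 : ℂ) 1, z ≠ 0 → deriv f z ≠ 0
  abs_arg_lt : ∀ z ∈ Metric.ball (0 : ℂ) 1, z ≠ 0 →
    |Complex.arg (z * deriv f z / f z)| < Real.pi * α / 2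

/-- The shifted hypergeometric function `z ↦ z ₂F₁(a, b; c; z)`. -/
noncomputable def shiftedHypergeometric (a b c : ℂ) (z : ℂ) : ℂ :=
  z * ordinaryHypergeometric a b c z

/-! Put `q = 1 + z F' / F` with `F = ₂F₁(a, b; a + b + 1; ·)`. For this third parameter the
first-order coefficient of the hypergeometric equation is a multiple of `1 - z`, so the equation
becomes the Riccati equation `z q' + (q - 1)(q + a + b - 1) = a b z / (1 - z)`, where `Re (z / (1 -
z)) > -1/2`. Suppose `q` fails to stay in the sector, and take a failing point `z₀` of least
modulus. The vertex and infinity are excluded by `ne_zero_of_mapsTo_sector`, applied to `q` and to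
`1 / q`. At any other boundary point Jack's lemma, transported to the sector by the power `1 / α`,
forces `z₀ q'(z₀) = (k α (s + s⁻¹) / 2) ε i q(z₀)` with `k ≥ 1`. Condition (i) makes the term in `k`
monotone, so `k = 1` is the worst case, and there (ii) contradicts the bound `-1/2`. -/

/-! ### Jack's lemma and its half-plane form -/

open Metric Filter Topology Set in
/-- **Jack's lemma.** If `ω` maps the disk of radius `R` into the unit disk with `ω 0 = 0` and
`|ω|` attains the value `1` at a boundary point `z₀`, then `z₀ ω'(z₀) = k ω(z₀)` with `k ≥ 1`. -/
theorem jack_lemma {ω : ℂ → ℂ} {R : ℝ} {z₀ d : ℂ} (hω : DifferentiableOn ℂ ω (ball 0 R))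
    (hmaps : ∀ z ∈ ball (0 : ℂ) R, ‖ω z‖ ≤ 1) (h0 : ω 0 = 0) (hz₀ : ‖z₀‖ = R)
    (hR : 0 < R) (hd : HasDerivAt ω d z₀) (h1 : ‖ω z₀‖ = 1) :
    ∃ k : ℝ, 1 ≤ k ∧ z₀ * d = k * ω z₀ := by
  have schwarz : ∀ z ∈ ball (0 : ℂ) R, ‖ω z‖ ≤ ‖z‖ / R := by
    intro z hz
    have := Complex.dist_le_div_mul_dist_of_mapsTo_ball (R₂ := 1) hω
      (fun w hw => by simpa [h0] using hmaps w hw) hz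
    simpa [h0, div_eq_inv_mul] using this
  set X : ℂ := (starRingEnd ℂ) (ω z₀) * (z₀ * d) with hX
  -- Schwarz gives `‖ω z‖ ≤ ‖z‖ / R`, with equality at `z₀`. Comparing the squares of both sides to
  -- first order along `z₀ exp (t l)`, which enters the disk for `t > 0`, yields the inequality.
  have key : ∀ l : ℂ, l.re < 0 → (X * l).re ≤ l.re := by
    intro l hl
    have hcurve : HasDerivAt (fun t : ℝ => z₀ * Complex.exp (t * l)) (z₀ * l) 0 := by
      have h2 : HasDerivAt (fun t : ℝ => (t : ℂ) * l) l 0 := by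
        simpa using (Complex.ofRealCLM.hasDerivAt (x := (0 : ℝ))).mul_const l
      simpa using (h2.cexp).const_mul z₀
    have hd' : HasDerivAt ω d ((fun t : ℝ => z₀ * Complex.exp (t * l)) 0) := by simpa using hd
    have hcomp := HasDerivAt.comp (0 : ℝ) hd' hcurve
    have hre : HasDerivAt (fun t : ℝ => ‖ω (z₀ * Complex.exp (t * l))‖ ^ 2) (2 * (X * l).re) 0 := by
      have he : (X * l).re = inner ℝ (ω z₀) (d * (z₀ * l)) := by
        rw [Complex.inner, hX]
        congr 1
        ring
      rw [he]
      simpa [Function.comp_def] using hcomp.norm_sq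
    have hexp : HasDerivAt (fun t : ℝ => Real.exp (2 * l.re * t)) (2 * l.re) 0 := by
      simpa using ((hasDerivAt_id (0 : ℝ)).const_mul (2 * l.re)).exp
    have hlim := (hexp.sub hre).tendsto_slope_zero_right
    have hnn : 0 ≤ 2 * l.re - 2 * (X * l).re := by
      refine ge_of_tendsto hlim ?_
      filter_upwards [self_mem_nhdsWithin] with t ht
      have ht : 0 < t := ht
      have hnorm : ‖z₀ * Complex.exp (t * l)‖ = R * Real.exp (l.re * t) := by
        rw [norm_mul, hz₀, Complex.norm_exp]; simp [mul_comm]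
      have hlt : Real.exp (l.re * t) < 1 := by
        rw [Real.exp_lt_one_iff]; exact mul_neg_of_neg_of_pos hl ht
      have hmem : z₀ * Complex.exp (t * l) ∈ ball (0 : ℂ) R := by
        rw [mem_ball_zero_iff, hnorm]; nlinarith
      have hle := schwarz _ hmem
      rw [hnorm, mul_div_cancel_left₀ _ hR.ne'] at hle
      have hsq : ‖ω (z₀ * Complex.exp (t * l))‖ ^ 2 ≤ Real.exp (2 * l.re * t) := by
        have : Real.exp (2 * l.re * t) = Real.exp (l.re * t) ^ 2 := by
          rw [← Real.exp_nat_mul]; congr 1; push_cast; ring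
        rw [this]
        exact pow_le_pow_left₀ (norm_nonneg _) hle 2
      have : 0 ≤ t⁻¹ * (Real.exp (2 * l.re * t) - ‖ω (z₀ * Complex.exp (t * l))‖ ^ 2) :=
        mul_nonneg (inv_nonneg.2 ht.le) (by linarith)
      simpa [h1] using this
    linarith
  have hre : 1 ≤ X.re := by simpa using key (-1) (by simp)
  have him : X.im = 0 := by
    by_contra hne
    -- This `l` makes `(X * l).re = 0` while `l.re = -1`.
    have := key (-1 + (-(X.re) / X.im) * Complex.I) (by
      simp [← Complex.ofReal_neg, ← Complex.ofReal_div])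
    simp [← Complex.ofReal_neg, ← Complex.ofReal_div] at this
    field_simp at this
    linarith
  refine ⟨X.re, hre, ?_⟩
  have hXe : (X.re : ℂ) = X := by apply Complex.ext <;> simp [him]
  have hc : (starRingEnd ℂ) (ω z₀) * ω z₀ = 1 := by
    rw [Complex.conj_mul', h1]; simp
  rw [hXe, hX]
  linear_combination (-(z₀ * d)) * hc

open Metric in
/-- Boundary derivative of a function with positive real part at a point where the real part
vanishes. -/
theorem boundary_deriv_of_re_pos {H : ℂ → ℂ} {R : ℝ} {z₀ d : ℂ}
    (hH : DifferentiableOn ℂ H (ball 0 R)) (hpos : ∀ z ∈ ball (0 : ℂ) R, 0 < (H z).re)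
    (hz₀ : ‖z₀‖ = R) (hR : 0 < R) (hd : HasDerivAt H d z₀) (h1 : (H z₀).re = 0) :
    ∃ k : ℝ, 1 ≤ k ∧ z₀ * d = ((-(k * ‖H z₀ - H 0‖ ^ 2 / (2 * (H 0).re)) : ℝ) : ℂ) := by
  have hp0 := hpos 0 (by simpa)
  have hden : ∀ w : ℂ, 0 ≤ w.re → w + (starRingEnd ℂ) (H 0) ≠ 0 := by
    intro w hw h
    have := congrArg Complex.re h
    simp at this
    linarith
  have hle : ∀ w : ℂ, 0 ≤ w.re → ‖w - H 0‖ ≤ ‖w + (starRingEnd ℂ) (H 0)‖ := by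
    intro w hw
    rw [← sq_le_sq₀ (norm_nonneg _) (norm_nonneg _), ← Complex.normSq_eq_norm_sq,
      ← Complex.normSq_eq_norm_sq, Complex.normSq_apply, Complex.normSq_apply]
    simp
    nlinarith [mul_nonneg hw hp0.le]
  have heq : ‖H z₀ - H 0‖ = ‖H z₀ + (starRingEnd ℂ) (H 0)‖ := by
    rw [← sq_eq_sq₀ (norm_nonneg _) (norm_nonneg _), ← Complex.normSq_eq_norm_sq,
      ← Complex.normSq_eq_norm_sq, Complex.normSq_apply, Complex.normSq_apply]
    simp [h1]
    ring
  have hne := hden (H z₀) h1.ge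
  -- The Cayley transform sends the right half-plane to the unit disk and `H 0` to `0`.
  obtain ⟨k, hk, he⟩ := jack_lemma (ω := fun z => (H z - H 0) / (H z + (starRingEnd ℂ) (H 0)))
    (R := R) (z₀ := z₀)
    ((hH.sub_const _).div (hH.add_const _) fun z hz => hden _ (hpos z hz).le)
    (fun z hz => by
      rw [norm_div]
      exact div_le_one_of_le₀ (hle _ (hpos z hz).le) (norm_nonneg _))
    (by simp) hz₀ hR ((hd.sub_const _).div (hd.add_const _) hne)
    (by rw [norm_div, heq, div_self (norm_ne_zero_iff.2 hne)])
  refine ⟨k, hk, ?_⟩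
  have hsum : H 0 + (starRingEnd ℂ) (H 0) = ((2 * (H 0).re : ℝ) : ℂ) := Complex.add_conj _
  have hnz : ((2 * (H 0).re : ℝ) : ℂ) ≠ 0 := by
    exact_mod_cast (by positivity : (2 * (H 0).re : ℝ) ≠ 0)
  have hconj : (starRingEnd ℂ) (H z₀ - H 0) = -(H z₀ + (starRingEnd ℂ) (H 0)) := by
    apply Complex.ext <;> simp [h1, add_comm]
  have hns : ((‖H z₀ - H 0‖ ^ 2 : ℝ) : ℂ) = -((H z₀ - H 0) * (H z₀ + (starRingEnd ℂ) (H 0))) := by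
    have := Complex.mul_conj' (H z₀ - H 0)
    rw [hconj] at this
    push_cast
    linear_combination -this
  have he' : z₀ * d * ((2 * (H 0).re : ℝ) : ℂ)
      = k * ((H z₀ - H 0) * (H z₀ + (starRingEnd ℂ) (H 0))) := by
    rw [← hsum]
    field_simp at he
    linear_combination he
  have : ((-(k * ‖H z₀ - H 0‖ ^ 2 / (2 * (H 0).re)) : ℝ) : ℂ)
      = -(k * ((‖H z₀ - H 0‖ ^ 2 : ℝ) : ℂ)) / ((2 * (H 0).re : ℝ) : ℂ) := by
    push_cast; ring
  rw [this, hns, eq_div_iff hnz, he']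
  ring

/-! ### The hypergeometric series and its differential equation -/

open Metric FormalMultilinearSeries Filter Topology

/-- The hypergeometric series converges on the unit disk. -/
theorem one_le_radius_ordinaryHypergeometricSeries {a b c : ℂ} (hc : ∀ n : ℕ, (n : ℂ) ≠ -c) :
    1 ≤ (ordinaryHypergeometricSeries ℂ a b c).radius := by
  by_cases ha : ∃ n : ℕ, (n : ℂ) = -a
  · obtain ⟨n, hn⟩ := ha
    rw [← neg_eq_iff_eq_neg.2 hn, ordinaryHypergeometric_radius_top_of_neg_nat₁]
    exact le_top
  by_cases hb : ∃ n : ℕ, (n : ℂ) = -b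
  · obtain ⟨n, hn⟩ := hb
    rw [← neg_eq_iff_eq_neg.2 hn, ordinaryHypergeometric_radius_top_of_neg_nat₂]
    exact le_top
  push Not at ha hb
  exact (ordinaryHypergeometricSeries_radius_eq_one ℂ a b c fun n => ⟨ha n, hb n, hc n⟩).ge

theorem hasFPowerSeriesOnBall_ordinaryHypergeometric {a b c : ℂ} (hc : ∀ n : ℕ, (n : ℂ) ≠ -c) :
    HasFPowerSeriesOnBall (ordinaryHypergeometric a b c : ℂ → ℂ)
      (ordinaryHypergeometricSeries ℂ a b c) 0 1 := by
  have h := one_le_radius_ordinaryHypergeometricSeries (a := a) (b := b) hc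
  exact (FormalMultilinearSeries.hasFPowerSeriesOnBall _ (zero_lt_one.trans_le h)).mono
    zero_lt_one h

theorem analyticOnNhd_ordinaryHypergeometric {a b c : ℂ} (hc : ∀ n : ℕ, (n : ℂ) ≠ -c) :
    AnalyticOnNhd ℂ (ordinaryHypergeometric a b c : ℂ → ℂ) (ball 0 1) := by
  have := (hasFPowerSeriesOnBall_ordinaryHypergeometric (a := a) (b := b) hc).analyticOnNhd
  rwa [← ENNReal.coe_one, eball_coe, NNReal.coe_one] at this

theorem iteratedDeriv_ordinaryHypergeometric_zero {a b c : ℂ} (hc : ∀ n : ℕ, (n : ℂ) ≠ -c)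
    (n : ℕ) : iteratedDeriv n (ordinaryHypergeometric a b c : ℂ → ℂ) 0
      = n.factorial * ordinaryHypergeometricCoefficient a b c n := by
  have h1 := (hasFPowerSeriesOnBall_ordinaryHypergeometric (a := a) (b := b) hc).hasFPowerSeriesAt
  have h2 := (analyticOnNhd_ordinaryHypergeometric (a := a) (b := b) hc 0 (by simp)).hasFPowerSeriesAt
  have h3 := congrFun (ofScalars_series_injective ℂ ℂ (h1.eq_formalMultilinearSeries h2)) n
  rw [h3, mul_div_cancel₀ _ (by exact_mod_cast n.factorial_ne_zero)]

theorem iteratedDeriv_succ_ordinaryHypergeometric_zero {a b c : ℂ} (hc : ∀ n : ℕ, (n : ℂ) ≠ -c)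
    (n : ℕ) : (c + n) * iteratedDeriv (n + 1) (ordinaryHypergeometric a b c : ℂ → ℂ) 0
      = (a + n) * (b + n) * iteratedDeriv n (ordinaryHypergeometric a b c : ℂ → ℂ) 0 := by
  rw [iteratedDeriv_ordinaryHypergeometric_zero hc, iteratedDeriv_ordinaryHypergeometric_zero hc]
  have hcn : c + n ≠ 0 := fun h => hc n (by linear_combination h)
  have hP : (ascPochhammer ℂ n).eval c ≠ 0 := by
    rw [Ne, ascPochhammer_eval_eq_zero_iff]
    rintro ⟨k, -, hk⟩
    exact hc k hk
  have h1 : ((n + 1).factorial : ℂ) ≠ 0 := by exact_mod_cast (Nat.factorial_ne_zero _)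
  have h2 : (n.factorial : ℂ) ≠ 0 := by exact_mod_cast (Nat.factorial_ne_zero _)
  simp only [ordinaryHypergeometricCoefficient, ascPochhammer_succ_eval]
  field_simp

/-- Multiplying an exponential generating function by the variable. -/
theorem HasSum.mul_egf {D : ℕ → ℂ} {z s : ℂ}
    (h : HasSum (fun n : ℕ => D (n + 1) * (z ^ n / n.factorial)) s) :
    HasSum (fun n : ℕ => (n * D n) * (z ^ n / n.factorial)) (z * s) := by
  rw [← hasSum_nat_add_iff' 1]
  simp only [Finset.range_one, Finset.sum_singleton, Nat.cast_zero, zero_mul, sub_zero]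
  convert! h.mul_left z using 2 with n
  have h1 : (n.factorial : ℂ) ≠ 0 := by exact_mod_cast n.factorial_ne_zero
  have h2 : (n : ℂ) + 1 ≠ 0 := by exact_mod_cast n.succ_ne_zero
  rw [Nat.factorial_succ]
  push_cast
  field_simp
  ring

/-- The hypergeometric differential equation. -/
theorem ordinaryHypergeometric_ode {a b c : ℂ} (hc : ∀ n : ℕ, (n : ℂ) ≠ -c) {z : ℂ}
    (hz : z ∈ ball (0 : ℂ) 1) :
    z * (1 - z) * deriv (deriv (ordinaryHypergeometric a b c : ℂ → ℂ)) z
      + (c - (a + b + 1) * z) * deriv (ordinaryHypergeometric a b c : ℂ → ℂ) z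
      - a * b * ordinaryHypergeometric a b c z = 0 := by
  set F : ℂ → ℂ := ordinaryHypergeometric a b c with hF
  set D : ℕ → ℂ := fun n => iteratedDeriv n F 0 with hD
  have hA : AnalyticOnNhd ℂ F (ball 0 1) := analyticOnNhd_ordinaryHypergeometric hc
  have taylor : ∀ m : ℕ, HasSum (fun n : ℕ => D (n + m) * (z ^ n / n.factorial))
      (iteratedDeriv m F z) := by
    intro m
    have hdm : DifferentiableOn ℂ (iteratedDeriv m F) (ball 0 1) := by
      rw [iteratedDeriv_eq_iterate]
      exact (hA.iterated_deriv m).differentiableOn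
    have := Complex.hasSum_taylorSeries_on_ball hdm hz
    convert! this using 2 with n
    simp only [hD, iteratedDeriv_eq_iterate, Function.iterate_add_apply, sub_zero, smul_eq_mul]
    ring
  have h0 := taylor 0
  have h1 := taylor 1
  have h2 := taylor 2
  have h1z := h1.mul_egf
  have h2z := HasSum.mul_egf (D := fun n => D (n + 1)) h2
  -- A second multiplication by `z` gives `z² F''`, with coefficients `n (n - 1) D n`.
  have h2zz := HasSum.mul_egf (D := fun n => (n - 1) * D n) (z := z) (s := z * iteratedDeriv 2 F z)
    (by simpa using h2z)
  have hall := ((h2z.sub h2zz).add ((h1.mul_left c).sub (h1z.mul_left (a + b + 1)))).sub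
    (h0.mul_left (a * b))
  have hzero : HasSum (fun _ : ℕ => (0 : ℂ)) 0 := hasSum_zero
  have this := hall.unique (by
    convert! hzero using 2 with n
    have := iteratedDeriv_succ_ordinaryHypergeometric_zero (a := a) (b := b) hc n
    simp only [hD, hF, add_zero]
    linear_combination (z ^ n / n.factorial) * this)
  rw [iteratedDeriv_succ, iteratedDeriv_one, iteratedDeriv_zero] at this
  linear_combination this


/-! ### Functions with values in a sector -/

theorem re_exp_mul_pos {w : ℂ} {t : ℝ} (hw : w ≠ 0) (h : |Complex.arg w + t| < Real.pi / 2) :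
    0 < (Complex.exp (t * Complex.I) * w).re := by
  have : Complex.exp (t * Complex.I) * w
      = ‖w‖ * Complex.exp ((Complex.arg w + t : ℝ) * Complex.I) := by
    conv_lhs => rw [← Complex.norm_mul_exp_arg_mul_I w]
    push_cast
    rw [add_mul, Complex.exp_add]
    ring
  rw [this, Complex.re_ofReal_mul, Complex.exp_ofReal_mul_I_re]
  exact mul_pos (norm_pos_iff.2 hw) (Real.cos_pos_of_mem_Ioo (abs_lt.1 h))

/-- A function with values in a convex sector inside a disk does not vanish at the boundary. -/
theorem ne_zero_of_mapsTo_sector {q : ℂ → ℂ} {R α : ℝ} {z₀ d : ℂ} (hα0 : 0 < α) (hα1 : α < 1)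
    (hq : DifferentiableOn ℂ q (ball 0 R))
    (hS : ∀ z ∈ ball (0 : ℂ) R, q z ≠ 0 ∧ |Complex.arg (q z)| < Real.pi * α / 2)
    (hz₀ : ‖z₀‖ = R) (hR : 0 < R) (hd : HasDerivAt q d z₀) : q z₀ ≠ 0 := by
  intro h0
  have hpi := Real.pi_pos
  -- Rotation by either angle `t` keeps the sector inside the right half-plane. A zero at `z₀` would
  -- make `z₀ * d` a negative multiple of two distinct directions.
  have key : ∀ t : ℝ, |t| = Real.pi * (1 - α) / 2 → ∃ x : ℝ, x < 0 ∧
      z₀ * (Complex.exp (t * Complex.I) * d) = x := by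
    intro t ht
    have hpos : ∀ z ∈ ball (0 : ℂ) R, 0 < (Complex.exp (t * Complex.I) * q z).re := by
      intro z hz
      refine re_exp_mul_pos (hS z hz).1 ((abs_add_le _ _).trans_lt ?_)
      have := (hS z hz).2
      rw [ht]
      linarith
    obtain ⟨k, hk, he⟩ := boundary_deriv_of_re_pos (hq.const_mul _) hpos hz₀ hR
      (hd.const_mul (Complex.exp (t * Complex.I))) (by simp [h0])
    refine ⟨_, ?_, he⟩
    have hp0 := hpos 0 (by simpa)
    have hne : Complex.exp (t * Complex.I) * q 0 ≠ 0 := fun h => by simp [h] at hp0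
    rw [h0, mul_zero, zero_sub, norm_neg]
    have := norm_pos_iff.2 hne
    have : 0 < k := by linarith
    exact neg_lt_zero.2 (by positivity)
  set β : ℝ := Real.pi * (1 - α) / 2 with hβ
  have hβ0 : 0 < β := by
    have : 0 < 1 - α := by linarith
    positivity
  have hβ1 : β < Real.pi / 2 := by nlinarith
  obtain ⟨x, hx, hxe⟩ := key β (abs_of_pos hβ0)
  obtain ⟨y, hy, hye⟩ := key (-β) (by rw [abs_neg, abs_of_pos hβ0])
  have hxy : (x : ℂ) = Complex.exp ((2 * β : ℝ) * Complex.I) * y := by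
    rw [← hxe, ← hye]
    have : Complex.exp (β * Complex.I)
        = Complex.exp ((2 * β : ℝ) * Complex.I) * Complex.exp ((-β : ℝ) * Complex.I) := by
      rw [← Complex.exp_add]; congr 1; push_cast; ring
    rw [this]
    ring
  have him := congrArg Complex.im hxy
  rw [Complex.im_mul_ofReal, Complex.exp_ofReal_mul_I_im, Complex.ofReal_im] at him
  have := Real.sin_pos_of_pos_of_lt_pi (x := 2 * β) (by linarith) (by linarith)
  exact (mul_neg_of_pos_of_neg this hy).ne him.symm

/-- Boundary behaviour of a function subordinate to `((1 + z) / (1 - z)) ^ α`. -/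
theorem boundary_deriv_of_mapsTo_sector {q : ℂ → ℂ} {R α : ℝ} {z₀ d : ℂ} (hα0 : 0 < α)
    (hα1 : α < 1) (hq : DifferentiableOn ℂ q (ball 0 R))
    (hS : ∀ z ∈ ball (0 : ℂ) R, q z ≠ 0 ∧ |Complex.arg (q z)| < Real.pi * α / 2)
    (h0 : q 0 = 1) (hz₀ : ‖z₀‖ = R) (hR : 0 < R) (hd : HasDerivAt q d z₀) (hne : q z₀ ≠ 0)
    (harg : |Complex.arg (q z₀)| = Real.pi * α / 2) :
    ∃ s : ℝ, 0 < s ∧ ∃ ε : ℝ, (ε = 1 ∨ ε = -1) ∧ ∃ k : ℝ, 1 ≤ k ∧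
      q z₀ = (s ^ α : ℝ) * Complex.exp (ε * Real.pi * Complex.I * α / 2) ∧
      z₀ * d = (k * α * (s + s⁻¹) / 2 : ℝ) * (ε * Complex.I) * q z₀ := by
  have hpi := Real.pi_pos
  obtain ⟨ε, hε, hεarg⟩ : ∃ ε : ℝ, (ε = 1 ∨ ε = -1) ∧
      Complex.arg (q z₀) = ε * (Real.pi * α / 2) := by
    rcases abs_choice (Complex.arg (q z₀)) with h | h
    · exact ⟨1, Or.inl rfl, by linarith⟩
    · exact ⟨-1, Or.inr rfl, by linarith⟩
  have slit : ∀ w : ℂ, w ≠ 0 → |Complex.arg w| ≤ Real.pi * α / 2 → w ∈ Complex.slitPlane := by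
    intro w hw h
    rw [Complex.mem_slitPlane_iff_arg]
    refine ⟨fun hpi' => ?_, hw⟩
    rw [hpi', abs_of_pos hpi] at h
    nlinarith
  have hcpow : ∀ w : ℂ, w ≠ 0 → w ^ ((1 / α : ℝ) : ℂ)
      = (‖w‖ ^ (1 / α) : ℝ) * Complex.exp ((Complex.arg w / α : ℝ) * Complex.I) := by
    intro w hw
    rw [Complex.cpow_def_of_ne_zero hw, Real.rpow_def_of_pos (norm_pos_iff.2 hw),
      Complex.ofReal_exp, ← Complex.exp_add, Complex.log]
    congr 1
    push_cast
    ring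
  have hεI : (ε * Complex.I) * (ε * Complex.I) = -1 := by rcases hε with rfl | rfl <;> simp
  have hexpε : Complex.exp ((ε * (Real.pi / 2) : ℝ) * Complex.I) = ε * Complex.I := by
    rcases hε with rfl | rfl
    · simp [Complex.exp_pi_div_two_mul_I]
    · have : ((-1 * (Real.pi / 2) : ℝ) : ℂ) * Complex.I = -(Real.pi / 2 * Complex.I) := by
        push_cast; ring
      rw [this, Complex.exp_neg, Complex.exp_pi_div_two_mul_I]
      simp
  set s : ℝ := ‖q z₀‖ ^ (1 / α) with hs
  have hs0 : 0 < s := Real.rpow_pos_of_pos (norm_pos_iff.2 hne) _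
  have hgz : q z₀ ^ ((1 / α : ℝ) : ℂ) = s * (ε * Complex.I) := by
    rw [hcpow _ hne, hεarg, ← hexpε]
    congr 4
    field_simp
  have hpos : ∀ z ∈ ball (0 : ℂ) R, 0 < (q z ^ ((1 / α : ℝ) : ℂ)).re := by
    intro z hz
    obtain ⟨h1, h2⟩ := hS z hz
    rw [hcpow _ h1, Complex.re_ofReal_mul, Complex.exp_ofReal_mul_I_re]
    refine mul_pos (Real.rpow_pos_of_pos (norm_pos_iff.2 h1) _)
      (Real.cos_pos_of_mem_Ioo (abs_lt.1 ?_))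
    rw [abs_div, abs_of_pos hα0, div_lt_iff₀ hα0]
    linarith
  -- The power `1 / α` opens the sector to the right half-plane; `H 0 = 1` and `H z₀ = ε i s`.
  obtain ⟨k, hk, he⟩ := boundary_deriv_of_re_pos (H := fun z => q z ^ ((1 / α : ℝ) : ℂ))
    (hq.cpow_const fun z hz => slit _ (hS z hz).1 (hS z hz).2.le) hpos hz₀ hR
    (hd.cpow_const (c := ((1 / α : ℝ) : ℂ)) (slit _ hne harg.le))
    (by simp only [hgz]; simp)
  refine ⟨s, hs0, ε, hε, k, hk, ?_, ?_⟩
  · conv_lhs => rw [← Complex.norm_mul_exp_arg_mul_I (q z₀)]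
    rw [hεarg, hs, ← Real.rpow_mul (norm_nonneg _), one_div_mul_cancel hα0.ne', Real.rpow_one]
    congr 2
    push_cast
    ring
  · have hnorm : ‖(s : ℂ) * (ε * Complex.I) - 1‖ ^ 2 = 1 + s ^ 2 := by
      rw [← Complex.normSq_eq_norm_sq, Complex.normSq_apply]
      rcases hε with rfl | rfl <;> simp <;> ring
    rw [Complex.cpow_sub _ _ hne, Complex.cpow_one] at he
    simp only [hgz, h0, Complex.one_cpow, hnorm, Complex.one_re] at he
    have hsC : (s : ℂ) ≠ 0 := by exact_mod_cast hs0.ne'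
    have hαC : (α : ℂ) ≠ 0 := by exact_mod_cast hα0.ne'
    push_cast at he ⊢
    field_simp at he ⊢
    linear_combination (-(ε : ℂ) * Complex.I) * he + (2 * z₀ * d * s) * hεI

/-- The reciprocal of `1 + z F' / F` extends differentiably across a zero of `F`. -/
theorem differentiableAt_div_add_mul_deriv {F : ℂ → ℂ} {z₀ : ℂ} (hF : AnalyticAt ℂ F z₀)
    (h0 : F z₀ = 0) (hne : ¬ ∀ᶠ z in 𝓝 z₀, F z = 0) (hz₀ : z₀ ≠ 0) :
    DifferentiableAt ℂ (fun z => F z / (F z + z * deriv F z)) z₀ := by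
  obtain ⟨n, E, hE, hEne, hev⟩ := hF.exists_eventuallyEq_pow_smul_nonzero_iff.2 hne
  obtain ⟨m, rfl⟩ : ∃ m, n = m + 1 := by
    refine Nat.exists_eq_succ_of_ne_zero ?_
    rintro rfl
    have := hev.self_of_nhds
    simp [h0] at this
    exact hEne this.symm
  have hev' : F =ᶠ[𝓝 z₀] fun z => (z - z₀) ^ (m + 1) * E z := hev
  have hmain : (fun z => F z / (F z + z * deriv F z)) =ᶠ[𝓝 z₀] fun z =>
      ((z - z₀) * E z) / ((z - z₀) * E z + z * ((m + 1) * E z + (z - z₀) * deriv E z)) := by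
    filter_upwards [hev', hev'.deriv, hE.eventually_analyticAt] with z h1 h2 h3
    have hdz : HasDerivAt (fun z => (z - z₀) ^ (m + 1) * E z)
        (((m + 1 : ℕ) : ℂ) * (z - z₀) ^ m * 1 * E z + (z - z₀) ^ (m + 1) * deriv E z) z := by
      simpa using (((hasDerivAt_id z).sub_const z₀).fun_pow (m + 1)).fun_mul
        h3.differentiableAt.hasDerivAt
    rw [h1, h2, hdz.deriv]
    -- At `z₀` both quotients have numerator `0`, so they agree even where the left one is `0 / 0`.
    by_cases hz : z = z₀
    · simp [hz]
    · have : (z - z₀) ^ m ≠ 0 := pow_ne_zero _ (sub_ne_zero.2 hz)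
      rw [← mul_div_mul_left ((z - z₀) * E z) _ this]
      congr 1
      · ring
      · push_cast; ring
  rw [hmain.differentiableAt_iff]
  have hE' := hE.deriv.differentiableAt
  have hEd := hE.differentiableAt
  refine DifferentiableAt.div (by fun_prop) (by fun_prop) ?_
  simp only [sub_self, zero_mul, zero_add, add_zero]
  exact mul_ne_zero hz₀ (mul_ne_zero (by exact_mod_cast m.succ_ne_zero) hEne)


/-- The jump of `arg` across the negative axis is only a change of sign, and `|arg z|` is the
arccosine of `z.re / ‖z‖`. -/
theorem Complex.continuousAt_abs_arg {w : ℂ} (hw : w ≠ 0) :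
    ContinuousAt (fun z => |Complex.arg z|) w := by
  have : (fun z => |Complex.arg z|) =ᶠ[𝓝 w] fun z => Real.arccos (z.re / ‖z‖) := by
    filter_upwards [isOpen_ne.mem_nhds hw] with z hz
    rw [← Complex.cos_arg hz, ← Real.cos_abs,
      Real.arccos_cos (abs_nonneg _) (Complex.abs_arg_le_pi z)]
  refine ContinuousAt.congr ?_ this.symm
  exact Real.continuous_arccos.continuousAt.comp
    (Complex.continuous_re.continuousAt.div continuous_norm.continuousAt (norm_ne_zero_iff.2 hw))

/-- A function on the unit disk, given by a quotient `1 + z F' / F`, takes values in a sector as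
soon as it does not reach the sides of the sector at finite nonzero points. -/
theorem mapsTo_sector_of_boundary {F : ℂ → ℂ} {α : ℝ} (hα0 : 0 < α) (hα1 : α < 1)
    (hF : AnalyticOnNhd ℂ F (ball 0 1)) (hF0 : F 0 ≠ 0)
    (hbd : ∀ z₀ ∈ ball (0 : ℂ) 1, F z₀ ≠ 0 → ∀ s : ℝ, 0 < s → ∀ ε : ℝ, (ε = 1 ∨ ε = -1) →
      ∀ k : ℝ, 1 ≤ k →
      1 + z₀ * deriv F z₀ / F z₀ = (s ^ α : ℝ) * Complex.exp (ε * Real.pi * Complex.I * α / 2) →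
      z₀ * deriv (fun z => 1 + z * deriv F z / F z) z₀ = (k * α * (s + s⁻¹) / 2 : ℝ) *
        (ε * Complex.I) * (1 + z₀ * deriv F z₀ / F z₀) → False) :
    ∀ z ∈ ball (0 : ℂ) 1, F z ≠ 0 ∧ 1 + z * deriv F z / F z ≠ 0 ∧
      |Complex.arg (1 + z * deriv F z / F z)| < Real.pi * α / 2 := by
  set q : ℂ → ℂ := fun z => 1 + z * deriv F z / F z with hqdef
  set θ : ℝ := Real.pi * α / 2 with hθ
  set P : ℂ → Prop := fun z => F z ≠ 0 ∧ q z ≠ 0 ∧ |Complex.arg (q z)| < θ with hP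
  have hdF : ∀ z ∈ ball (0 : ℂ) 1, F z ≠ 0 → DifferentiableAt ℂ q z := by
    intro z hz h
    have h1 := (hF z hz).differentiableAt
    have h2 := (hF z hz).deriv.differentiableAt
    exact (DifferentiableAt.div (by fun_prop) h1 h).const_add 1
  have hopen : ∀ z ∈ ball (0 : ℂ) 1, P z → ∀ᶠ w in 𝓝 z, P w := by
    rintro z hz ⟨h1, h2, h3⟩
    have hc := (hdF z hz h1).continuousAt
    exact ((hF z hz).continuousAt.eventually_ne h1).and ((hc.eventually_ne h2).and
      (((Complex.continuousAt_abs_arg h2).comp hc).eventually_lt_const h3))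
  change ∀ z ∈ ball (0 : ℂ) 1, P z
  by_contra hcon
  push Not at hcon
  obtain ⟨z₁, hz₁, hPz₁⟩ := hcon
  have hz₁n : ‖z₁‖ < 1 := by simpa using hz₁
  have hsub : closedBall (0 : ℂ) ‖z₁‖ ⊆ ball 0 1 := closedBall_subset_ball hz₁n
  have hcpt : IsCompact (closedBall (0 : ℂ) ‖z₁‖ ∩ {z | ¬ P z}) := by
    refine (isCompact_closedBall (0 : ℂ) ‖z₁‖).of_isClosed_subset ?_ Set.inter_subset_left
    rw [← isOpen_compl_iff, isOpen_iff_mem_nhds]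
    intro z hz
    by_cases hzb : z ∈ closedBall (0 : ℂ) ‖z₁‖
    · have hPz : P z := by
        by_contra h
        exact hz ⟨hzb, h⟩
      filter_upwards [hopen z (hsub hzb) hPz] with w hw h
      exact h.2 hw
    · filter_upwards [isClosed_closedBall.isOpen_compl.mem_nhds hzb] with w hw h
      exact hw h.1
  obtain ⟨z₀, ⟨hz₀b, hz₀P⟩, hmin⟩ := hcpt.exists_isMinOn ⟨z₁, by simp, hPz₁⟩
    continuous_norm.continuousOn
  have hz₀1 : z₀ ∈ ball (0 : ℂ) 1 := hsub hz₀b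
  have hS' : ∀ z ∈ ball (0 : ℂ) ‖z₀‖, P z := by
    intro z hz
    by_contra h
    rw [mem_ball_zero_iff] at hz
    have hz₀b' : ‖z₀‖ ≤ ‖z₁‖ := by simpa using hz₀b
    have hle : ‖z₀‖ ≤ ‖z‖ := hmin ⟨by simpa using hz.le.trans hz₀b', h⟩
    linarith
  have hball : ball (0 : ℂ) ‖z₀‖ ⊆ ball 0 1 := ball_subset_ball (mem_ball_zero_iff.1 hz₀1).le
  have hq0 : q 0 = 1 := by simp [hqdef]
  have hθ0 : 0 < θ := by have := Real.pi_pos; positivity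
  have hz₀ : z₀ ≠ 0 := by
    rintro rfl
    exact hz₀P ⟨hF0, by simp [hq0], by simpa [hq0] using hθ0⟩
  have hR : 0 < ‖z₀‖ := norm_pos_iff.2 hz₀
  have hS : ∀ z ∈ ball (0 : ℂ) ‖z₀‖, q z ≠ 0 ∧ |Complex.arg (q z)| < θ := fun z hz => (hS' z hz).2
  have hqd : DifferentiableOn ℂ q (ball 0 ‖z₀‖) := fun z hz =>
    (hdF z (hball hz) (hS' z hz).1).differentiableWithinAt
  by_cases hFz : F z₀ = 0
  · have hnev : ¬ ∀ᶠ z in 𝓝 z₀, F z = 0 := by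
      intro hev
      exact hF0 (hF.eqOn_zero_of_preconnected_of_eventuallyEq_zero
        (convex_ball (0 : ℂ) 1).isPreconnected hz₀1 hev (by simp))
    have hinv : ∀ z ∈ ball (0 : ℂ) ‖z₀‖, F z / (F z + z * deriv F z) = (q z)⁻¹ := by
      intro z hz
      have h1 := (hS' z hz).1
      simp only [hqdef]
      rw [one_add_div h1, inv_div]
    -- A zero of `F` is a pole of `q`: the extension of `1 / q` stays in the same sector inside the
    -- disk and would reach its vertex at `z₀`.
    refine ne_zero_of_mapsTo_sector hα0 hα1
      (q := fun z => F z / (F z + z * deriv F z)) (R := ‖z₀‖) (z₀ := z₀) ?_ ?_ rfl hR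
      (differentiableAt_div_add_mul_deriv (hF z₀ hz₀1) hFz hnev hz₀).hasDerivAt (by simp [hFz])
    · exact (hqd.inv fun z hz => (hS z hz).1).congr hinv
    · intro z hz
      simp only [hinv z hz]
      exact ⟨inv_ne_zero (hS z hz).1, by rw [Complex.abs_arg_inv]; exact (hS z hz).2⟩
  · have hd := (hdF z₀ hz₀1 hFz).hasDerivAt
    have hqne := ne_zero_of_mapsTo_sector hα0 hα1 hqd hS rfl hR hd
    have hge : θ ≤ |Complex.arg (q z₀)| := by
      by_contra h
      exact hz₀P ⟨hFz, hqne, not_le.1 h⟩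
    have hle : |Complex.arg (q z₀)| ≤ θ := by
      have hcl : z₀ ∈ closure (ball (0 : ℂ) ‖z₀‖) := by
        rw [closure_ball _ hR.ne']; simp
      have hc : ContinuousAt (fun z => |Complex.arg (q z)|) z₀ :=
        (Complex.continuousAt_abs_arg hqne).comp hd.continuousAt
      have := mem_closure_iff_nhdsWithin_neBot.1 hcl
      refine le_of_tendsto (x := 𝓝[ball 0 ‖z₀‖] z₀) (hc.tendsto.mono_left nhdsWithin_le_nhds) ?_
      filter_upwards [self_mem_nhdsWithin] with z hz using (hS z hz).2.le
    obtain ⟨s, hs, ε, hε, k, hk, he1, he2⟩ := boundary_deriv_of_mapsTo_sector hα0 hα1 hqd hS hq0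
      rfl hR hd hqne (le_antisymm hle hge)
    exact hbd z₀ hz₀1 hFz s hs ε hε k hk he1 he2

/-! ### The Riccati equation and the conclusion -/

theorem neg_half_lt_re_div_one_sub {z : ℂ} (hz : z ∈ ball (0 : ℂ) 1) :
    -(1 / 2) < (z / (1 - z)).re := by
  have hz1 : ‖z‖ < 1 := by simpa using hz
  have hne : 1 - z ≠ 0 := by
    intro h
    rw [← sub_eq_zero.1 h] at hz1
    simp at hz1
  have hpos := Complex.normSq_pos.2 hne
  have hsq : Complex.normSq z < 1 := by
    rw [Complex.normSq_eq_norm_sq]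
    nlinarith [norm_nonneg z]
  rw [Complex.div_re, ← add_div, lt_div_iff₀ hpos]
  rw [Complex.normSq_apply] at *
  simp at *
  nlinarith

/-- The Riccati equation for the logarithmic derivative of the hypergeometric function with
`c = a + b + 1`. -/
theorem ordinaryHypergeometric_riccati {a b : ℂ} (hc : ∀ n : ℕ, (n : ℂ) ≠ -(a + b + 1)) {z : ℂ}
    (hz : z ∈ ball (0 : ℂ) 1) (hFz : ordinaryHypergeometric a b (a + b + 1) z ≠ 0) :
    let F : ℂ → ℂ := ordinaryHypergeometric a b (a + b + 1)
    let q : ℂ → ℂ := fun z => 1 + z * deriv F z / F z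
    z * deriv q z + (q z - 1) * (q z + a + b - 1) = a * b * (z / (1 - z)) := by
  intro F q
  have hA := analyticOnNhd_ordinaryHypergeometric (a := a) (b := b) hc z hz
  have hode := ordinaryHypergeometric_ode (a := a) (b := b) hc hz
  change AnalyticAt ℂ F z at hA
  change z * (1 - z) * deriv (deriv F) z + (a + b + 1 - (a + b + 1) * z) * deriv F z
    - a * b * F z = 0 at hode
  change F z ≠ 0 at hFz
  have hne : 1 - z ≠ 0 := by
    intro h
    rw [← sub_eq_zero.1 h] at hz
    simp at hz
  have hd : HasDerivAt q (((1 * deriv F z + z * deriv (deriv F) z) * F z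
      - z * deriv F z * deriv F z) / F z ^ 2) z :=
    ((((hasDerivAt_id z).mul hA.deriv.differentiableAt.hasDerivAt).div
      hA.differentiableAt.hasDerivAt hFz).const_add 1)
  rw [hd.deriv]
  simp only [q]
  field_simp
  linear_combination z * F z * hode

/-- The sector boundary is excluded by the hypothesis on `a * b`. -/
theorem boundary_contradiction {α : ℝ} {a b : ℂ} (hab : a * b ≠ 0)
    {s ε k u : ℝ} {e w q D : ℂ} (hk : 1 ≤ k)
    (hw : -(1 / 2) < w.re)
    (hpos : 0 ≤ α * (s + s⁻¹) * u * (ε * Complex.I * e * (a * b)).re)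
    (hineq : 2 * u ^ 2 * (e ^ 2 * (a * b)).re
        + 2 * u * (e * (a * b) * (starRingEnd ℂ a + starRingEnd ℂ b - 2)).re
        + ‖a * b‖ ^ 2 - 2 * (a * b * (starRingEnd ℂ a + starRingEnd ℂ b - 1)).re
      ≤ α * (s + s⁻¹) * u * (ε * Complex.I * e * (a * b)).re)
    (hq : q = u * (starRingEnd ℂ) e)
    (hD : D = (k * α * (s + s⁻¹) / 2 : ℝ) * (ε * Complex.I) * q)
    (heq : D + (q - 1) * (q + a + b - 1) = a * b * w) : False := by
  set A := a * b with hA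
  have hApos : 0 < ‖A‖ ^ 2 := by have := norm_pos_iff.2 hab; positivity
  -- Pairing the Riccati equation with `A` isolates `w.re`, which exceeds `-1/2`; twice the
  -- expansion of the left side is compared with `hineq`.
  have h1 : (A * (starRingEnd ℂ) (D + (q - 1) * (q + a + b - 1))).re = ‖A‖ ^ 2 * w.re := by
    rw [heq, map_mul, ← mul_assoc, Complex.mul_conj', ← Complex.ofReal_pow, Complex.re_ofReal_mul,
      Complex.conj_re]
  have h2 : A * (starRingEnd ℂ) (D + (q - 1) * (q + a + b - 1))
      = ((-(k * (α * (s + s⁻¹) * u) / 2) : ℝ) : ℂ) * (ε * Complex.I * e * A)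
        + ((u ^ 2 : ℝ) : ℂ) * (e ^ 2 * A)
        + (u : ℂ) * (e * A * (starRingEnd ℂ a + starRingEnd ℂ b - 2))
        - A * (starRingEnd ℂ a + starRingEnd ℂ b - 1) := by
    rw [hD, hq]
    simp only [map_add, map_sub, map_mul, map_one, Complex.conj_ofReal, Complex.conj_I,
      Complex.conj_conj]
    push_cast
    ring
  rw [h2, Complex.sub_re, Complex.add_re, Complex.add_re, Complex.re_ofReal_mul,
    Complex.re_ofReal_mul, Complex.re_ofReal_mul] at h1
  nlinarith

theorem mainTheorem8 (α : ℝ) (hα0 : 0 < α) (hα1 : α < 1) (a b : ℂ)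
    (hc : ∀ n : ℕ, a + b ≠ -((n : ℂ) + 1))
    (hab : a * b ≠ 0)
    (harg : |Complex.arg (a * b)| < Real.pi * α / 2)
    (hineq : ∀ s : ℝ, 0 < s → ∀ ε : ℝ, ε = 1 ∨ ε = -1 →
      2 * s ^ (2 * α) * (Complex.exp (-(ε * Real.pi * Complex.I * α)) * (a * b)).re
        + 2 * s ^ α *
          (Complex.exp (-(ε * Real.pi * Complex.I * α / 2)) * (a * b) *
            (starRingEnd ℂ a + starRingEnd ℂ b - 2)).re
        + ‖a * b‖ ^ 2 - 2 * (a * b * (starRingEnd ℂ a + starRingEnd ℂ b - 1)).re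
      ≤ α * (s + s⁻¹) * s ^ α *
          (Complex.exp (ε * Real.pi * Complex.I * (1 - α) / 2) * (a * b)).re) :
    IsStronglyStarlikeOfOrder α (shiftedHypergeometric a b (a + b + 1)) := by
  have hpi := Real.pi_pos
  have hc' : ∀ n : ℕ, (n : ℂ) ≠ -(a + b + 1) := fun n h => hc n (by linear_combination h)
  set F : ℂ → ℂ := ordinaryHypergeometric a b (a + b + 1) with hFdef
  have hF : AnalyticOnNhd ℂ F (ball 0 1) := analyticOnNhd_ordinaryHypergeometric hc'
  have hF0 : F 0 = 1 := ordinaryHypergeometric_zero a b (a + b + 1)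
  have hmain := mapsTo_sector_of_boundary hα0 hα1 hF (by simp [hF0]) (by
    intro z hz hFz s hs ε hε k hk hq hD
    have hexp : Complex.exp (ε * Real.pi * Complex.I * (1 - α) / 2)
        = ε * Complex.I * Complex.exp (-(ε * Real.pi * Complex.I * α / 2)) := by
      have h1 : (ε * Real.pi * Complex.I * (1 - α) / 2 : ℂ)
          = ε * (Real.pi / 2 * Complex.I) + -(ε * Real.pi * Complex.I * α / 2) := by ring
      rw [h1, Complex.exp_add]
      congr 1
      rcases hε with rfl | rfl
      · simp [Complex.exp_pi_div_two_mul_I]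
      · simp [Complex.exp_neg, Complex.exp_pi_div_two_mul_I]
    -- The rotation by `π (1 - α) / 2` and `|arg (a b)| < π α / 2` add up to less than `π / 2`.
    have hre : 0 ≤ (Complex.exp (ε * Real.pi * Complex.I * (1 - α) / 2) * (a * b)).re := by
      have h1 : (ε * Real.pi * Complex.I * (1 - α) / 2 : ℂ)
          = (ε * (Real.pi * (1 - α) / 2) : ℝ) * Complex.I := by push_cast; ring
      rw [h1]
      refine (re_exp_mul_pos hab ((abs_add_le _ _).trans_lt ?_)).le
      have hε1 : |ε| = 1 := by rcases hε with rfl | rfl <;> simp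
      have : 0 ≤ Real.pi * (1 - α) / 2 := by
        have : 0 < 1 - α := by linarith
        positivity
      rw [abs_mul, hε1, abs_of_nonneg this]
      linarith
    have hi := hineq s hs ε hε
    rw [hexp] at hre hi
    refine boundary_contradiction (α := α) (s := s) (ε := ε) (u := s ^ α)
      (e := Complex.exp (-(ε * Real.pi * Complex.I * α / 2))) hab hk
      (neg_half_lt_re_div_one_sub hz) (mul_nonneg (by positivity) hre) ?_ ?_ hD
      (ordinaryHypergeometric_riccati hc' hz hFz)
    · have h1 : (s ^ α) ^ 2 = s ^ (2 * α) := by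
        rw [← Real.rpow_natCast, ← Real.rpow_mul hs.le]
        congr 1
        push_cast
        ring
      have h2 : Complex.exp (-(ε * Real.pi * Complex.I * α / 2)) ^ 2
          = Complex.exp (-(ε * Real.pi * Complex.I * α)) := by
        rw [← Complex.exp_nat_mul]
        congr 1
        push_cast
        ring
      rw [h1, h2]
      exact hi
    · rw [hq, ← Complex.exp_conj]
      congr 2
      simp only [map_neg, map_div₀, map_mul, Complex.conj_ofReal, Complex.conj_I, map_ofNat]
      ring)
  have hder : ∀ z ∈ ball (0 : ℂ) 1,
      deriv (shiftedHypergeometric a b (a + b + 1)) z = F z + z * deriv F z := by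
    intro z hz
    have := ((hasDerivAt_id z).mul (hF z hz).differentiableAt.hasDerivAt).deriv
    rw [_root_.id, one_mul] at this
    exact this
  have hval : ∀ z, shiftedHypergeometric a b (a + b + 1) z = z * F z := fun z => rfl
  have hquot : ∀ z ∈ ball (0 : ℂ) 1, z ≠ 0 →
      z * deriv (shiftedHypergeometric a b (a + b + 1)) z
        / shiftedHypergeometric a b (a + b + 1) z = 1 + z * deriv F z / F z := by
    intro z hz hz0
    have := (hmain z hz).1
    rw [hder z hz, hval, mul_div_mul_left _ _ hz0, add_div, div_self this]
  refine ⟨fun z hz => analyticAt_id.mul (hF z hz), by simp [hval], ?_, ?_, ?_, ?_⟩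
  · rw [hder 0 (by simp), hF0]
    simp
  · intro z hz hz0
    exact mul_ne_zero hz0 (hmain z hz).1
  · intro z hz hz0 h
    have := hquot z hz hz0
    rw [h, mul_zero, zero_div] at this
    exact (hmain z hz).2.1 this.symm
  · intro z hz hz0
    rw [hquot z hz hz0]
    exact (hmain z hz).2.2
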